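/- Let $(p_{ij})_{1\le i,j\le K}$ be the transition matrix of an irreducible, aperiodic Markov chain on the finite state space $\Sigma=\{1,\dots,K\}$, and fix an initial state $i_0\in\Sigma$. Define nested boxes indexed by words over $\Sigma$: the box of the empty word has size $1$ and type $i_0$, and a box of type $i$ and size $s$ is split at the next generation into boxes of types $k\in\Sigma$ with sizes $s\,p_{ik}$. Thus the boxes $b_u$ of generation $n$ are indexed by the words $u\in\Sigma^n$, and their sizes $|b_u|$ sum to $1$. Let $L_n$ be the size of a size-biased pick of a box of generation $n$, that is, $L_n=|b_U|$ where $\mathbb P(U=u)=|b_u|$ for $u\in\Sigma^n$. For $\theta\in\mathbb R$ let $A(\theta)=(p_{ij}^\theta)_{i,j\in\Sigma}$, with the convention $p_{ij}^\theta=0$ if $p_{ij}=0$, and let $\rho(\theta)$ be the maximum modulus eigenvalue of $A(\theta)$, i.e. the real simple root of its characteristic polynomial whose modulus is strictly larger than that of every other complex root. This eigenvalue exists for every $\theta$, is positive, and is differentiable as a function of $\theta$. Put $$z_n(\theta)=e^{n\rho'(\theta)/\rho(\theta)},\qquad \phi(\theta)=\ln\rho(\theta)-(\theta-1)\frac{\rho'(\theta)}{\rho(\theta)},\qquad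 \psi(\theta)=\ln\rho(\theta)-\theta\,\frac{\rho'(\theta)}{\rho(\theta)}.$$ Then for every $\theta\in\mathbb R$ one has $-\infty<\phi(\theta)\le 0$, $$\lim_{\varepsilon\downarrow0}\ \lim_{n\to\infty}\frac1n\ln\mathbb P\Big(L_n\in\big(z_n(\theta)e^{-n\varepsilon},\,z_n(\theta)e^{n\varepsilon}\big)\Big)=\phi(\theta),$$ and $$\lim_{\varepsilon\downarrow0}\ \lim_{n\to\infty}\frac1n\ln\#\Big\{u\in\Sigma^n:\ |b_u|\in\big(z_n(\theta)e^{-n\varepsilon},\,z_n(\theta)e^{n\varepsilon}\big)\Big\}=\psi(\theta).$$ In both cases, for every $\varepsilon>0$ the argument of the logarithm is positive for all sufficiently large $n$, and the inner limit exists in $\mathbb R$. -/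

import Mathlib

open Filter Topology MeasureTheory

noncomputable section

namespace MarkovBoxes

/-- Aperiodicity of a transition matrix: for every state `i`, the greatest common divisor of the
possible return times `{n ≥ 1 | (p ^ n) i i > 0}` is `1`. -/
def IsAperiodic {K : ℕ} (p : Matrix (Fin K) (Fin K) ℝ) : Prop :=
  ∀ (i : Fin K) (d : ℕ), (∀ n : ℕ, 1 ≤ n → 0 < (p ^ n) i i → d ∣ n) → d = 1

/-- The matrix `A(θ) = (p_{ij}^θ)`, with the convention `p_{ij}^θ = 0` whenever `p_{ij} = 0`. -/
def powMatrix {K : ℕ} (p : Matrix (Fin K) (Fin K) ℝ) (θ : ℝ) : Matrix (Fin K) (Fin K) ℝ :=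
  Matrix.of fun i j => if p i j = 0 then 0 else p i j ^ θ

/-- `r` is a maximum modulus eigenvalue of `M`: it is a simple root of the characteristic
polynomial, and its modulus is strictly larger than that of every other complex root. -/
def IsMaxModulusEigenvalue {K : ℕ} (M : Matrix (Fin K) (Fin K) ℝ) (r : ℝ) : Prop :=
  (M.map (algebraMap ℝ ℂ)).charpoly.rootMultiplicity (r : ℂ) = 1 ∧
    ∀ z : ℂ, (M.map (algebraMap ℝ ℂ)).charpoly.IsRoot z → z ≠ (r : ℂ) → ‖z‖ < |r|

theorem IsMaxModulusEigenvalue.unique {K : ℕ} {M : Matrix (Fin K) (Fin K) ℝ} {r s : ℝ}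
    (hr : IsMaxModulusEigenvalue M r) (hs : IsMaxModulusEigenvalue M s) : r = s := by
  by_contra hne
  have root : ∀ {t : ℝ}, IsMaxModulusEigenvalue M t →
      (M.map (algebraMap ℝ ℂ)).charpoly.IsRoot (t : ℂ) := fun ht =>
    (Polynomial.rootMultiplicity_pos (Matrix.charpoly_monic _).ne_zero).1 (by rw [ht.1]; norm_num)
  have h1 := hr.2 _ (root hs) (by exact_mod_cast Ne.symm hne)
  have h2 := hs.2 _ (root hr) (by exact_mod_cast hne)
  simp only [Complex.norm_real, Real.norm_eq_abs] at h1 h2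
  exact lt_asymm h1 h2

/-- The maximum modulus eigenvalue `ρ(θ)` of `A(θ)`. -/
def rho {K : ℕ} (p : Matrix (Fin K) (Fin K) ℝ) (θ : ℝ) : ℝ :=
  Classical.epsilon fun r : ℝ => IsMaxModulusEigenvalue (powMatrix p θ) r

/-- `φ(θ) = ln ρ(θ) - (θ - 1) ρ'(θ) / ρ(θ)`. -/
def phi {K : ℕ} (p : Matrix (Fin K) (Fin K) ℝ) (θ : ℝ) : ℝ :=
  Real.log (rho p θ) - (θ - 1) * (deriv (rho p) θ / rho p θ)

/-- `ψ(θ) = ln ρ(θ) - θ ρ'(θ) / ρ(θ)`. -/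
def psi {K : ℕ} (p : Matrix (Fin K) (Fin K) ℝ) (θ : ℝ) : ℝ :=
  Real.log (rho p θ) - θ * (deriv (rho p) θ / rho p θ)

/-- The type of a box: the initial box (empty word) has type `i₀`, and the box of the word
`(i_1, …, i_n)` with `n ≥ 1` has type `i_n`. -/
def boxType {K : ℕ} (i₀ : Fin K) : (n : ℕ) → (Fin n → Fin K) → Fin K
  | 0, _ => i₀
  | n + 1, u => u (Fin.last n)

/-- The size of the box of a word: the initial box has size `1`, and a box of type `i` is split into
sub-boxes of type `k` with relative sizes `p i k`. -/
def boxSize {K : ℕ} (p : Matrix (Fin K) (Fin K) ℝ) (i₀ : Fin K) :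
    (n : ℕ) → (Fin n → Fin K) → ℝ
  | 0, _ => 1
  | n + 1, u => boxSize p i₀ n (Fin.init u) * p (boxType i₀ n (Fin.init u)) (u (Fin.last n))

/-- The law of a size-biased pick of a box of generation `n`: each box is picked with probability
equal to its size. On this space, the variable `L_n` is `boxSize p i₀ n`. -/
def sizeBiasedPick {K : ℕ} (p : Matrix (Fin K) (Fin K) ℝ) (i₀ : Fin K) (n : ℕ) :
    Measure (Fin n → Fin K) :=
  ∑ u : Fin n → Fin K, ENNReal.ofReal (boxSize p i₀ n u) • Measure.dirac u

/-- The interval `(z_n(θ) e^{-nε}, z_n(θ) e^{nε})`, where `z_n(θ) = e^{n ρ'(θ) / ρ(θ)}`. -/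
def sizeWindow {K : ℕ} (p : Matrix (Fin K) (Fin K) ℝ) (θ ε : ℝ) (n : ℕ) : Set ℝ :=
  Set.Ioo (Real.exp (n * (deriv (rho p) θ / rho p θ)) * Real.exp (-(n * ε)))
    (Real.exp (n * (deriv (rho p) θ / rho p θ)) * Real.exp (n * ε))

/-- `P(L_n ∈ (z_n(θ) e^{-nε}, z_n(θ) e^{nε}))`. -/
def windowProb {K : ℕ} (p : Matrix (Fin K) (Fin K) ℝ) (i₀ : Fin K) (θ ε : ℝ) (n : ℕ) : ℝ :=
  (sizeBiasedPick p i₀ n).real {u | boxSize p i₀ n u ∈ sizeWindow p θ ε n}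

/-- The number of boxes of generation `n` with size in `(z_n(θ) e^{-nε}, z_n(θ) e^{nε})`. -/
def windowCount {K : ℕ} (p : Matrix (Fin K) (Fin K) ℝ) (i₀ : Fin K) (θ ε : ℝ) (n : ℕ) : ℕ :=
  {u : Fin n → Fin K | boxSize p i₀ n u ∈ sizeWindow p θ ε n}.ncard

/-- `lim_{ε ↓ 0} lim_{n → ∞} (1/n) ln (a ε n) = l`: for every `ε > 0` the numbers `a ε n` are positive
for large `n` (so that their logarithms are meaningful), the inner limit exists in `ℝ`,
and the inner limits converge to `l` as `ε ↓ 0`. -/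
def HasExpRate (a : ℝ → ℕ → ℝ) (l : ℝ) : Prop :=
  ∃ g : ℝ → ℝ,
    (∀ ε : ℝ, 0 < ε → (∀ᶠ n : ℕ in atTop, 0 < a ε n) ∧
      Tendsto (fun n : ℕ => 1 / (n : ℝ) * Real.log (a ε n)) atTop (𝓝 (g ε))) ∧
    Tendsto g (𝓝[>] 0) (𝓝 l)

end MarkovBoxes

end

/-! Write Λ = ln ρ. Weighting each power |b_u|^t by the Perron eigenvector of A(t) turns the moment
Σ|b_u|^t into an exact multiple of ρ(t)^n, so the unweighted moment is comparable to ρ(t)^n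
(`exists_bounds_sum_zeroPow`). Hence Λ plays the role of a limiting cumulant generating function for
ln|b_u|. The probability and the count are both sums of |b_u|^τ over a window, with τ = 1 and τ = 0,
and one large deviation argument of Gärtner–Ellis type handles both.

The upper bound is Chernoff's: change the exponent from τ to t and use the full moment
(`exists_windowSum_le`). For the lower bound, differentiability of Λ makes the tails away from the
exponent Λ'(t) exponentially negligible under the tilt t (`exists_le_windowSum`). At t = θ both
bounds give Λ(θ) + (τ - θ)Λ'(θ) as ε → 0. For fixed ε, the inner limit is a Legendre-type value at
the point of the window closest to Λ'(τ) (`exists_legendre_value`). The tangent inequality for Λ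
follows from the same bounds; since Λ(1) = 0, it yields φ ≤ 0.

The matrix input is Perron–Frobenius theory for the primitive matrices A(θ), together with
`differentiableAt_rho`. -/

/-- Small positive multiples of a real number lie below any positive number. -/
theorem eventually_mul_lt_of_pos (y : ℝ) {C : ℝ} (hC : 0 < C) :
    ∀ᶠ e in 𝓝[>] (0 : ℝ), e * y < C := by
  have h : Tendsto (fun e : ℝ => e * y) (𝓝 0) (𝓝 (0 * y)) :=
    (continuous_id.mul continuous_const).tendsto 0
  rw [zero_mul] at h
  exact (h.mono_left nhdsWithin_le_nhds).eventually_lt_const hC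

/-! ### Perron–Frobenius theory for primitive matrices. -/

namespace Matrix

variable {n : Type*} [Fintype n]

theorem mulVec_pos_of_pos {B : Matrix n n ℝ} (hB : ∀ i j, 0 < B i j) {d : n → ℝ}
    (hd : ∀ i, 0 ≤ d i) (hne : d ≠ 0) (i : n) : 0 < (B *ᵥ d) i := by
  obtain ⟨j, hj⟩ := Function.ne_iff.1 hne
  exact (Finset.sum_pos_iff_of_nonneg fun l _ => mul_nonneg (hB i l).le (hd l)).2
    ⟨j, Finset.mem_univ _, mul_pos (hB i j) (lt_of_le_of_ne (hd j) (Ne.symm hj))⟩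

/-- `r` is an eigenvalue of `A` with a right eigenvector `x` and a left eigenvector `w`, all
positive. -/
structure IsPerronTriple (A : Matrix n n ℝ) (r : ℝ) (x w : n → ℝ) : Prop where
  pos : 0 < r
  right_pos : ∀ i, 0 < x i
  left_pos : ∀ i, 0 < w i
  mulVec_eq : A *ᵥ x = r • x
  vecMul_eq : w ᵥ* A = r • w

theorem dotProduct_pos_of_pos [Nonempty n] {w x : n → ℝ} (hw : ∀ i, 0 < w i)
    (hx : ∀ i, 0 < x i) : 0 < w ⬝ᵥ x :=
  Finset.sum_pos (fun i _ => mul_pos (hw i) (hx i)) Finset.univ_nonempty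

/-- A left and a right positive eigenvector belong to the same eigenvalue. -/
theorem eigenvalue_eq_of_pos [Nonempty n] {A : Matrix n n ℝ} {r s : ℝ} {x w : n → ℝ}
    (hx : ∀ i, 0 < x i) (hw : ∀ i, 0 < w i) (h₁ : A *ᵥ x = r • x) (h₂ : w ᵥ* A = s • w) :
    r = s := by
  have h := dotProduct_mulVec w A x
  rw [h₁, h₂, dotProduct_smul, smul_dotProduct] at h
  exact mul_right_cancel₀ (dotProduct_pos_of_pos hw hx).ne' h

/-- Consequently the complex hyperplane w·v = 0 is invariant under A, and it contains every
eigenvector whose eigenvalue is not r. -/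
theorem IsPerronTriple.sum_left_mul_mulVec {A : Matrix n n ℝ} {r : ℝ} {x w : n → ℝ}
    (h : A.IsPerronTriple r x w) (v : n → ℂ) :
    ∑ j, (w j : ℂ) * (A.map (algebraMap ℝ ℂ) *ᵥ v) j = r * ∑ j, (w j : ℂ) * v j := by
  have hw : ∀ j, ∑ i, (w i : ℂ) * (A i j : ℂ) = r * w j := fun j => by
    have := congrFun h.vecMul_eq j
    exact_mod_cast congrArg (Complex.ofReal) this
  simp only [mulVec, dotProduct, map_apply, Complex.coe_algebraMap, Finset.mul_sum]
  rw [Finset.sum_comm]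
  refine Finset.sum_congr rfl fun j _ => ?_
  rw [← mul_assoc, ← hw, Finset.sum_mul]
  exact Finset.sum_congr rfl fun i _ => by ring

variable [DecidableEq n]

/-- Positivity of an entry of a power of a nonnegative matrix depends only on the zero pattern. -/
theorem pow_pos_congr {A B : Matrix n n ℝ} (hA : ∀ i j, 0 ≤ A i j) (hB : ∀ i j, 0 ≤ B i j)
    (h : ∀ i j, 0 < A i j ↔ 0 < B i j) (k : ℕ) (i j : n) :
    0 < (A ^ k) i j ↔ 0 < (B ^ k) i j := by
  have key : ∀ {a b : ℝ}, 0 ≤ a → 0 ≤ b → (0 < a * b ↔ 0 < a ∧ 0 < b) := fun ha hb =>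
    ⟨fun h => ⟨pos_of_mul_pos_left h hb, pos_of_mul_pos_right h ha⟩, fun h => mul_pos h.1 h.2⟩
  induction k generalizing i j with
  | zero => simp
  | succ k ih =>
    rw [pow_succ, pow_succ, mul_apply, mul_apply,
      Finset.sum_pos_iff_of_nonneg fun l _ => mul_nonneg (pow_apply_nonneg hA k i l) (hA l j),
      Finset.sum_pos_iff_of_nonneg fun l _ => mul_nonneg (pow_apply_nonneg hB k i l) (hB l j)]
    simp only [key (pow_apply_nonneg hA k i _) (hA _ j), key (pow_apply_nonneg hB k i _) (hB _ j),
      ih, h]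

theorem IsPrimitive.congr {A B : Matrix n n ℝ} (hB : B.IsPrimitive) (hA : ∀ i j, 0 ≤ A i j)
    (h : ∀ i j, 0 < A i j ↔ 0 < B i j) : A.IsPrimitive :=
  let ⟨k, hk, hpos⟩ := hB.exists_pos_pow
  ⟨hA, k, hk, fun i j => (pow_pos_congr hA hB.nonneg h k i j).2 (hpos i j)⟩

theorem IsPrimitive.transpose {A : Matrix n n ℝ} (hA : A.IsPrimitive) : Aᵀ.IsPrimitive :=
  let ⟨k, hk, hpos⟩ := hA.exists_pos_pow
  ⟨fun i j => hA.nonneg j i, k, hk, fun i j => by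
    rw [← transpose_pow]; exact hpos j i⟩

theorem pow_pos_mul {A : Matrix n n ℝ} (hA : ∀ i j, 0 ≤ A i j) {a b : ℕ} {i j l : n}
    (h₁ : 0 < (A ^ a) i j) (h₂ : 0 < (A ^ b) j l) : 0 < (A ^ (a + b)) i l := by
  rw [pow_add, mul_apply]
  exact (Finset.sum_pos_iff_of_nonneg fun m _ =>
    mul_nonneg (pow_apply_nonneg hA a i m) (pow_apply_nonneg hA b m l)).2
      ⟨j, Finset.mem_univ _, mul_pos h₁ h₂⟩

/-- An irreducible aperiodic nonnegative matrix is primitive. -/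
theorem IsIrreducible.isPrimitive {A : Matrix n n ℝ} (hA : A.IsIrreducible)
    (haper : ∀ (i : n) (d : ℕ), (∀ m : ℕ, 1 ≤ m → 0 < (A ^ m) i i → d ∣ m) → d = 1) :
    A.IsPrimitive := by
  have hirr := (isIrreducible_iff_exists_pow_pos hA.nonneg).1 hA
  have hev : ∀ i j, ∀ᶠ m : ℕ in atTop, 0 < (A ^ m) i j := by
    intro i j
    -- The return times form a submonoid of ℕ with gcd 1, hence contain all large integers; a path
    -- from i to j is then appended.
    let R : AddSubmonoid ℕ :=
      { carrier := {m | 0 < (A ^ m) i i}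
        zero_mem' := by simp
        add_mem' := fun ha hb => pow_pos_mul hA.nonneg ha hb }
    have hgcd : Nat.setGcd (R : Set ℕ) = 1 :=
      haper i _ fun m _ hm => Nat.setGcd_dvd_of_mem hm
    obtain ⟨N, hN⟩ := Nat.exists_mem_closure_of_ge (R : Set ℕ)
    obtain ⟨k, -, hk⟩ := hirr i j
    filter_upwards [eventually_ge_atTop (N + k)] with m hm
    have h := hN (m - k) (by omega) (by rw [hgcd]; exact one_dvd _)
    rw [AddSubmonoid.closure_eq] at h
    have := pow_pos_mul hA.nonneg h hk
    rwa [Nat.sub_add_cancel (by omega)] at this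
  obtain ⟨m, hm, hm1⟩ := ((eventually_all.2 fun i => eventually_all.2 (hev i)).and
    (eventually_ge_atTop 1)).exists
  exact ⟨hA.nonneg, m, hm1, hm⟩

theorem pow_mulVec_eq {R : Type*} [CommRing R] {A : Matrix n n R} {x : n → R} {r : R}
    (h : A *ᵥ x = r • x) (k : ℕ) : A ^ k *ᵥ x = r ^ k • x := by
  induction k with
  | zero => simp
  | succ k ih => rw [pow_succ, ← mulVec_mulVec, h, mulVec_smul, ih, smul_smul, pow_succ']

theorem vecMul_pow_eq {R : Type*} [CommRing R] {A : Matrix n n R} {w : n → R} {r : R}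
    (h : w ᵥ* A = r • w) (k : ℕ) : w ᵥ* A ^ k = r ^ k • w := by
  induction k with
  | zero => simp
  | succ k ih => rw [pow_succ', ← vecMul_vecMul, h, smul_vecMul, ih, smul_smul, pow_succ']

/-- A primitive matrix has a positive eigenvector in the standard simplex. -/
theorem IsPrimitive.exists_eigenvector [Nonempty n] {A : Matrix n n ℝ} (hA : A.IsPrimitive) :
    ∃ r : ℝ, 0 < r ∧ ∃ x : n → ℝ, x ∈ stdSimplex ℝ n ∧ (∀ i, 0 < x i) ∧ A *ᵥ x = r • x := by
  obtain ⟨k, hk, hB⟩ := hA.exists_pos_pow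
  set C : ℝ := ∑ i, ∑ j, A i j
  have hcont : ∀ i, Continuous fun q : ℝ × (n → ℝ) => (A *ᵥ q.2) i := fun i => by
    simp only [mulVec, dotProduct]; fun_prop
  -- Collatz–Wielandt: the Perron root is the largest l with l y ≤ A y for some y in the simplex;
  -- summing coordinates bounds l by C.
  let S : Set (ℝ × (n → ℝ)) :=
    (Set.Icc 0 C ×ˢ stdSimplex ℝ n) ∩ {q | ∀ i, q.1 * q.2 i ≤ (A *ᵥ q.2) i}
  have hS : IsCompact S := by
    refine (isCompact_Icc.prod (isCompact_stdSimplex ℝ n)).inter_right ?_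
    simp only [Set.ofPred_forall]
    exact isClosed_iInter fun i => isClosed_le (by fun_prop) (hcont i)
  have hmem : ∀ l : ℝ, ∀ y ∈ stdSimplex ℝ n, 0 ≤ l → (∀ i, l * y i ≤ (A *ᵥ y) i) →
      (l, y) ∈ S := by
    refine fun l y hy hl h => ⟨⟨⟨hl, ?_⟩, hy⟩, h⟩
    calc l = ∑ i, l * y i := by rw [← Finset.mul_sum, hy.2, mul_one]
      _ ≤ ∑ i, (A *ᵥ y) i := Finset.sum_le_sum fun i _ => h i
      _ ≤ C := Finset.sum_le_sum fun i _ => Finset.sum_le_sum fun j _ =>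
        mul_le_of_le_one_right (hA.nonneg i j) (by
          rw [← hy.2]; exact Finset.single_le_sum (fun l _ => hy.1 l) (Finset.mem_univ j))
  have hnonneg : ∀ y ∈ stdSimplex ℝ n, ∀ i, 0 ≤ (A *ᵥ y) i := fun y hy i =>
    Finset.sum_nonneg fun j _ => mul_nonneg (hA.nonneg i j) (hy.1 j)
  have hSne : S.Nonempty := by
    obtain ⟨i₀⟩ := ‹Nonempty n›
    exact ⟨_, hmem 0 _ (single_mem_stdSimplex ℝ i₀) le_rfl fun i => by
      simpa only [zero_mul] using hnonneg _ (single_mem_stdSimplex ℝ i₀) i⟩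
  obtain ⟨⟨r, x⟩, ⟨⟨⟨hr0, -⟩, hx⟩, hle⟩, hmax⟩ := hS.exists_isMaxOn hSne continuous_fst.continuousOn
  simp only [Set.mem_ofPred_eq] at hr0 hx hle
  have hxne : x ≠ 0 := by
    rintro rfl
    simpa using hx.2
  have hypos := mulVec_pos_of_pos hB hx.1 hxne
  have heq : A *ᵥ x = r • x := by
    by_contra hne
    -- If A x ≠ r x, the positive matrix A^k makes the nonnegative defect A x - r x strictly
    -- positive. Then A y exceeds r y in every coordinate, and r could be increased.
    set y := A ^ k *ᵥ x
    have hd := mulVec_pos_of_pos hB (d := A *ᵥ x - r • x)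
      (fun i => by simpa using hle i) (sub_ne_zero.2 hne)
    have hAy : A *ᵥ y = r • y + A ^ k *ᵥ (A *ᵥ x - r • x) := by
      rw [mulVec_sub, mulVec_smul, add_sub_cancel, mulVec_mulVec, mulVec_mulVec, pow_mul_comm']
    have hev : ∀ i, ∀ᶠ e in 𝓝[>] (0 : ℝ), e * y i ≤ (A ^ k *ᵥ (A *ᵥ x - r • x)) i := fun i =>
      (eventually_mul_lt_of_pos _ (hd i)).mono fun _ h => h.le
    obtain ⟨e, he, he0⟩ := ((eventually_all.2 hev).and self_mem_nhdsWithin).exists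
    have hs : 0 < ∑ i, y i := Finset.sum_pos (fun i _ => hypos i) Finset.univ_nonempty
    have hin := hmem (r + e) ((∑ i, y i)⁻¹ • y)
      ⟨fun i => mul_nonneg (inv_nonneg.2 hs.le) (hypos i).le, by
        simp only [Pi.smul_apply, smul_eq_mul, ← Finset.mul_sum]
        exact inv_mul_cancel₀ hs.ne'⟩ (add_nonneg hr0 (le_of_lt he0)) (fun i => by
        rw [mulVec_smul, hAy]
        simp only [Pi.smul_apply, smul_eq_mul, Pi.add_apply]
        rw [mul_left_comm]
        exact mul_le_mul_of_nonneg_left (by linarith [he i]) (inv_nonneg.2 hs.le))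
    have h1 : r + e ≤ r := hmax hin
    have h2 : 0 < e := he0
    linarith
  have hpow : ∀ i, 0 < r ^ k * x i := fun i => by
    have := hypos i
    rwa [pow_mulVec_eq heq] at this
  have hxpos : ∀ i, 0 < x i := fun i => pos_of_mul_pos_right (hpow i) (pow_nonneg hr0 k)
  have hr : 0 < r := by
    refine lt_of_le_of_ne hr0 fun h => ?_
    obtain ⟨i₀⟩ := ‹Nonempty n›
    have := hpow i₀
    rw [← h, zero_pow hk.ne', zero_mul] at this
    exact lt_irrefl _ this
  exact ⟨r, hr, x, hx, hxpos, heq⟩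

theorem IsPrimitive.exists_isPerronTriple [Nonempty n] {A : Matrix n n ℝ} (hA : A.IsPrimitive) :
    ∃ r x w, x ∈ stdSimplex ℝ n ∧ A.IsPerronTriple r x w := by
  obtain ⟨r, hr, x, hxs, hx, hAx⟩ := hA.exists_eigenvector
  obtain ⟨s, hs, w, -, hw, hAw⟩ := hA.transpose.exists_eigenvector
  rw [mulVec_transpose] at hAw
  obtain rfl := eigenvalue_eq_of_pos hx hw hAx hAw
  exact ⟨r, x, w, hxs, hr, hx, hw, hAx, hAw⟩

/-- Eigenvectors orthogonal to the left Perron vector belong to eigenvalues of smaller modulus. -/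
theorem IsPerronTriple.norm_lt [Nonempty n] {A : Matrix n n ℝ} {r : ℝ} {x w : n → ℝ}
    (h : A.IsPerronTriple r x w) (hA : A.IsPrimitive) {z : ℂ} {v : n → ℂ} (hv : v ≠ 0)
    (hz : A.map (algebraMap ℝ ℂ) *ᵥ v = z • v) (hwv : ∑ j, (w j : ℂ) * v j = 0) : ‖z‖ < r := by
  obtain ⟨k, hk, hB⟩ := hA.exists_pos_pow
  -- For small e the matrix A^k - e x wᵀ is still nonnegative and acts on v as A^k does, because w·v
  -- = 0. Its left eigenvalue at w is only r^k - e (w·x), which bounds ‖z‖^k.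
  have hev : ∀ i j, ∀ᶠ e in 𝓝[>] (0 : ℝ), e * (x i * w j) ≤ (A ^ k) i j := fun i j =>
    (eventually_mul_lt_of_pos _ (hB i j)).mono fun _ h => h.le
  obtain ⟨e, he, he0⟩ := ((eventually_all.2 fun i => eventually_all.2 (hev i)).and
    self_mem_nhdsWithin).exists
  replace he0 : 0 < e := he0
  have hzk := pow_mulVec_eq hz k
  rw [← Matrix.map_pow] at hzk
  have hnorm : ∀ i, ‖z‖ ^ k * ‖v i‖ ≤ ∑ j, ((A ^ k) i j - e * (x i * w j)) * ‖v j‖ := by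
    intro i
    have h1 : ∑ j, (((A ^ k) i j : ℝ) : ℂ) * v j = z ^ k * v i := congrFun hzk i
    have h2 : ∑ j, (((A ^ k) i j - e * (x i * w j) : ℝ) : ℂ) * v j = z ^ k * v i := by
      rw [← h1, ← sub_eq_zero, ← Finset.sum_sub_distrib]
      have : ∀ j, (((A ^ k) i j - e * (x i * w j) : ℝ) : ℂ) * v j - (((A ^ k) i j : ℝ) : ℂ) * v j
          = (-(e * x i : ℝ) : ℂ) * ((w j : ℂ) * v j) := fun j => by push_cast; ring
      simp only [this, ← Finset.mul_sum, hwv, mul_zero]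
    rw [← norm_pow, ← norm_mul, ← h2]
    refine (norm_sum_le _ _).trans_eq (Finset.sum_congr rfl fun j _ => ?_)
    rw [norm_mul, Complex.norm_real, Real.norm_of_nonneg (sub_nonneg.2 (he i j))]
  set T := ∑ j, w j * ‖v j‖
  have hT : 0 < T := by
    obtain ⟨j, hj⟩ := Function.ne_iff.1 hv
    exact (Finset.sum_pos_iff_of_nonneg fun l _ => mul_nonneg (h.left_pos l).le (norm_nonneg _)).2
      ⟨j, Finset.mem_univ _, mul_pos (h.left_pos j) (norm_pos_iff.2 hj)⟩
  have hwk : ∀ j, ∑ i, w i * (A ^ k) i j = r ^ k * w j := fun j =>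
    congrFun (vecMul_pow_eq h.vecMul_eq k) j
  have hsum : ‖z‖ ^ k * T ≤ (r ^ k - e * (w ⬝ᵥ x)) * T := by
    calc ‖z‖ ^ k * T = ∑ i, w i * (‖z‖ ^ k * ‖v i‖) := by
          rw [Finset.mul_sum]; exact Finset.sum_congr rfl fun i _ => by ring
      _ ≤ ∑ i, w i * ∑ j, ((A ^ k) i j - e * (x i * w j)) * ‖v j‖ :=
          Finset.sum_le_sum fun i _ => mul_le_mul_of_nonneg_left (hnorm i) (h.left_pos i).le
      _ = ∑ j, ∑ i, w i * (((A ^ k) i j - e * (x i * w j)) * ‖v j‖) := by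
          simp only [Finset.mul_sum]; exact Finset.sum_comm
      _ = ∑ j, (r ^ k - e * (w ⬝ᵥ x)) * (w j * ‖v j‖) := by
          refine Finset.sum_congr rfl fun j _ => ?_
          have : ∀ i, w i * (((A ^ k) i j - e * (x i * w j)) * ‖v j‖)
              = (w i * (A ^ k) i j) * ‖v j‖ - (w i * x i) * (e * w j * ‖v j‖) := fun i => by ring
          simp only [this, Finset.sum_sub_distrib, ← Finset.sum_mul, hwk, dotProduct]
          ring
      _ = _ := by rw [Finset.mul_sum]
  have hlt : ‖z‖ ^ k < r ^ k := by
    have h1 := le_of_mul_le_mul_right hsum hT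
    have h2 := mul_pos he0 (dotProduct_pos_of_pos h.left_pos h.right_pos)
    linarith
  exact lt_of_pow_lt_pow_left₀ k h.pos.le hlt

variable [Nonempty n] {A : Matrix n n ℝ} {r : ℝ} {x w : n → ℝ}

theorem IsPerronTriple.norm_lt_of_isRoot (h : A.IsPerronTriple r x w) (hA : A.IsPrimitive) {z : ℂ}
    (hz : (A.map (algebraMap ℝ ℂ)).charpoly.IsRoot z) (hne : z ≠ r) : ‖z‖ < r := by
  rw [← charpoly_toLin', ← Module.End.hasEigenvalue_iff_isRoot_charpoly] at hz
  obtain ⟨v, hv⟩ := hz.exists_hasEigenvector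
  have hzv := hv.apply_eq_smul
  rw [toLin'_apply] at hzv
  refine h.norm_lt hA hv.2 hzv ?_
  have h1 := h.sum_left_mul_mulVec v
  rw [hzv] at h1
  simp only [Pi.smul_apply, smul_eq_mul, mul_left_comm _ z, ← Finset.mul_sum] at h1
  by_contra h0
  exact hne (mul_right_cancel₀ h0 h1)

/-- The algebraic multiplicity is the dimension of the maximal generalized eigenspace. By `norm_lt`,
f - r is injective on the invariant hyperplane w·v = 0, so only the line through x remains. -/
theorem IsPerronTriple.rootMultiplicity_eq_one (h : A.IsPerronTriple r x w) (hA : A.IsPrimitive) :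
    (A.map (algebraMap ℝ ℂ)).charpoly.rootMultiplicity (r : ℂ) = 1 := by
  set f : Module.End ℂ (n → ℂ) := toLin' (A.map (algebraMap ℝ ℂ)) with hf
  have hinj : ∀ (k : ℕ) (u : n → ℂ), ∑ j, (w j : ℂ) * u j = 0 →
      ((f - (r : ℂ) • (1 : Module.End ℂ (n → ℂ))) ^ k) u = 0 → u = 0 := by
    intro k
    induction k with
    | zero => intro u _ hu; simpa using hu
    | succ k ih =>
      intro u hwu hu
      rw [pow_succ, Module.End.mul_apply] at hu
      have h1 := ih _ (by
        simp only [LinearMap.sub_apply, LinearMap.smul_apply, Module.End.one_apply, hf,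
          toLin'_apply, Pi.sub_apply, mul_sub, Finset.sum_sub_distrib, h.sum_left_mul_mulVec,
          Pi.smul_apply, smul_eq_mul, mul_left_comm _ (r : ℂ), ← Finset.mul_sum, hwu]
        simp) hu
      by_contra hne
      rw [LinearMap.sub_apply, sub_eq_zero, LinearMap.smul_apply, Module.End.one_apply, hf,
        toLin'_apply] at h1
      have := h.norm_lt hA hne h1 hwu
      rw [Complex.norm_real, Real.norm_of_nonneg h.pos.le] at this
      exact lt_irrefl _ this
  set xc : n → ℂ := fun i => (x i : ℂ)
  have hxc : f xc = (r : ℂ) • xc := by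
    ext i
    have : ∑ j, A i j * x j = r * x i := congrFun h.mulVec_eq i
    change ∑ j, (A i j : ℂ) * (x j : ℂ) = (r : ℂ) * (x i : ℂ)
    exact_mod_cast congrArg Complex.ofReal this
  have hxmem : xc ∈ f.maxGenEigenspace r :=
    (Module.End.genEigenspace_le_maximal f r 1) (by simpa [Module.End.mem_genEigenspace_one])
  have hwx : ∑ j, (w j : ℂ) * xc j ≠ 0 := by
    have : ∑ j, w j * x j ≠ 0 := (dotProduct_pos_of_pos h.left_pos h.right_pos).ne'
    change ∑ j, (w j : ℂ) * (x j : ℂ) ≠ 0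
    exact_mod_cast this
  have hx0 : xc ≠ 0 := by
    intro h0
    apply hwx
    simp [h0]
  have hspan : f.maxGenEigenspace r = Submodule.span ℂ {xc} := by
    refine le_antisymm (fun v hv => ?_) ((Submodule.span_singleton_le_iff_mem _ _).2 hxmem)
    set c : ℂ := (∑ j, (w j : ℂ) * v j) / ∑ j, (w j : ℂ) * xc j
    have hmem : v - c • xc ∈ f.maxGenEigenspace r := sub_mem hv (Submodule.smul_mem _ _ hxmem)
    obtain ⟨k, hk⟩ := (Module.End.mem_maxGenEigenspace f r _).1 hmem
    have := hinj k (v - c • xc) (by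
      simp only [Pi.sub_apply, Pi.smul_apply, smul_eq_mul, mul_sub, Finset.sum_sub_distrib,
        mul_left_comm _ c, ← Finset.mul_sum, c]
      rw [div_mul_cancel₀ _ hwx, sub_self]) hk
    exact Submodule.mem_span_singleton.2 ⟨c, (sub_eq_zero.1 this).symm⟩
  rw [← charpoly_toLin', ← LinearMap.finrank_maxGenEigenspace_eq, ← hf, hspan,
    finrank_span_singleton hx0]

end Matrix

open scoped Matrix in
theorem Matrix.IsPerronTriple.eq_smul {n : Type*} [Fintype n] [DecidableEq n] [Nonempty n]
    {A : Matrix n n ℝ} {r : ℝ} {x w : n → ℝ} (h : A.IsPerronTriple r x w) (hA : A.IsPrimitive)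
    {y : n → ℝ} (hy : A *ᵥ y = r • y) : y = ((w ⬝ᵥ y) / (w ⬝ᵥ x)) • x := by
  have hwx := (Matrix.dotProduct_pos_of_pos h.left_pos h.right_pos).ne'
  set c := (w ⬝ᵥ y) / (w ⬝ᵥ x)
  by_contra hne
  have hd : A *ᵥ (y - c • x) = r • (y - c • x) := by
    rw [Matrix.mulVec_sub, Matrix.mulVec_smul, hy, h.mulVec_eq, smul_sub, smul_comm]
  have hwd : w ⬝ᵥ (y - c • x) = 0 := by
    rw [dotProduct_sub, dotProduct_smul, smul_eq_mul, div_mul_cancel₀ _ hwx, sub_self]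
  set d := y - c • x
  have hd0 : (fun i => (d i : ℂ)) ≠ 0 := fun h0 => by
    refine hne (sub_eq_zero.1 (funext fun i => ?_))
    exact Complex.ofReal_eq_zero.1 (congrFun h0 i)
  have := h.norm_lt hA (z := (r : ℂ)) hd0 (by
    ext i
    have : ∑ j, A i j * d j = r * d i := congrFun hd i
    change ∑ j, (A i j : ℂ) * (d j : ℂ) = (r : ℂ) * (d i : ℂ)
    exact_mod_cast congrArg Complex.ofReal this) (by
    have : ∑ j, w j * d j = 0 := hwd
    exact_mod_cast congrArg Complex.ofReal this)
  rw [Complex.norm_real, Real.norm_of_nonneg h.pos.le] at this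
  exact lt_irrefl _ this

/-! ### The eigenvalue ρ(θ) and its differentiability. -/

namespace MarkovBoxes

variable {K : ℕ} {p : Matrix (Fin K) (Fin K) ℝ}

theorem powMatrix_isPrimitive (hp : p.IsPrimitive) (θ : ℝ) : (powMatrix p θ).IsPrimitive := by
  have hpos : ∀ i j, p i j ≠ 0 → 0 < p i j ^ θ := fun i j h =>
    Real.rpow_pos_of_pos (lt_of_le_of_ne (hp.nonneg i j) (Ne.symm h)) θ
  refine hp.congr (fun i j => ?_) (fun i j => ?_)
  · by_cases h : p i j = 0
    · simp [powMatrix, h]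
    · simpa [powMatrix, h] using (hpos i j h).le
  · by_cases h : p i j = 0
    · simp [powMatrix, h]
    · simpa [powMatrix, h, lt_of_le_of_ne (hp.nonneg i j) (Ne.symm h)] using hpos i j h

theorem isMaxModulusEigenvalue_of_isPerronTriple [Nonempty (Fin K)]
    {A : Matrix (Fin K) (Fin K) ℝ} (hA : A.IsPrimitive) {r : ℝ} {x w : Fin K → ℝ}
    (h : A.IsPerronTriple r x w) : IsMaxModulusEigenvalue A r :=
  ⟨h.rootMultiplicity_eq_one hA, fun z hz hne => by
    rw [abs_of_pos h.pos]
    exact h.norm_lt_of_isRoot hA hz hne⟩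

theorem exists_isPerronTriple_rho [Nonempty (Fin K)] (hp : p.IsPrimitive) (θ : ℝ) :
    ∃ x w, x ∈ stdSimplex ℝ (Fin K) ∧ (powMatrix p θ).IsPerronTriple (rho p θ) x w := by
  have hA := powMatrix_isPrimitive hp θ
  obtain ⟨r, x, w, hx, h⟩ := hA.exists_isPerronTriple
  have hr := isMaxModulusEigenvalue_of_isPerronTriple hA h
  have : rho p θ = r := (Classical.epsilon_spec ⟨r, hr⟩ : IsMaxModulusEigenvalue _ _).unique hr
  exact ⟨x, w, hx, this ▸ h⟩

theorem isMaxModulusEigenvalue_rho [Nonempty (Fin K)] (hp : p.IsPrimitive) (θ : ℝ) :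
    IsMaxModulusEigenvalue (powMatrix p θ) (rho p θ) :=
  let ⟨_, _, _, h⟩ := exists_isPerronTriple_rho hp θ
  isMaxModulusEigenvalue_of_isPerronTriple (powMatrix_isPrimitive hp θ) h

theorem rho_pos [Nonempty (Fin K)] (hp : p.IsPrimitive) (θ : ℝ) : 0 < rho p θ :=
  let ⟨_, _, _, h⟩ := exists_isPerronTriple_rho hp θ
  h.pos

theorem differentiableAt_powMatrix (p : Matrix (Fin K) (Fin K) ℝ) (θ : ℝ) (i j : Fin K) :
    DifferentiableAt ℝ (fun t => powMatrix p t i j) θ := by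
  by_cases h : p i j = 0
  · simp [powMatrix, h]
  · simp only [powMatrix, Matrix.of_apply, h, if_false]
    exact (differentiableAt_const _).rpow differentiableAt_id h

-- Pairing with the left eigenvector at θ gives an exact formula (`key`) for ρ(t) - ρ(θ) in terms of
-- A(t) - A(θ) and x(t). It yields continuity of ρ, from which continuity of the normalized
-- eigenvector at θ follows; dividing the formula by t - θ then gives the derivative.
open scoped Matrix in
theorem differentiableAt_rho [Nonempty (Fin K)] (hp : p.IsPrimitive) (θ : ℝ) :
    DifferentiableAt ℝ (rho p) θ := by
  choose x w hx h using fun t => exists_isPerronTriple_rho hp t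
  set A := powMatrix p
  set v := w θ
  have hA : ∀ i j, Tendsto (fun t => A t i j) (𝓝 θ) (𝓝 (A θ i j)) := fun i j =>
    (differentiableAt_powMatrix p θ i j).continuousAt
  have hbdd : ∀ j, IsBoundedUnder (· ≤ ·) (𝓝 θ) ((‖·‖) ∘ fun t => x t j) := fun j =>
    isBoundedUnder_of ⟨1, fun t => by
      rw [Function.comp, Real.norm_of_nonneg ((hx t).1 j), ← (hx t).2]
      exact Finset.single_le_sum (fun l _ => (hx t).1 l) (Finset.mem_univ j)⟩
  have hAx : ∀ i j, Tendsto (fun t => (A t i j - A θ i j) * x t j) (𝓝 θ) (𝓝 0) := fun i j =>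
    Tendsto.zero_mul_isBoundedUnder_le (tendsto_sub_nhds_zero_iff.2 (hA i j)) (hbdd j)
  have hvx : ∀ t, 0 < v ⬝ᵥ x t := fun t =>
    Matrix.dotProduct_pos_of_pos (h θ).left_pos (h t).right_pos
  have key : ∀ t, rho p t - rho p θ
      = (∑ i, v i * ∑ j, (A t i j - A θ i j) * x t j) * (v ⬝ᵥ x t)⁻¹ := by
    intro t
    rw [eq_mul_inv_iff_mul_eq₀ (hvx t).ne']
    have h1 : v ⬝ᵥ (A t *ᵥ x t) = rho p t * (v ⬝ᵥ x t) := by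
      rw [(h t).mulVec_eq, dotProduct_smul, smul_eq_mul]
    have h2 : v ⬝ᵥ (A θ *ᵥ x t) = rho p θ * (v ⬝ᵥ x t) := by
      rw [Matrix.dotProduct_mulVec, (h θ).vecMul_eq, smul_dotProduct, smul_eq_mul]
    rw [sub_mul, ← h1, ← h2, ← dotProduct_sub, ← Matrix.sub_mulVec]
    rfl
  have hrho : Tendsto (rho p) (𝓝 θ) (𝓝 (rho p θ)) := by
    rw [← tendsto_sub_nhds_zero_iff]
    simp only [key]
    refine Tendsto.zero_mul_isBoundedUnder_le ?_ ?_
    · have := tendsto_finsetSum Finset.univ fun i _ => (tendsto_finsetSum Finset.univ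
        fun j _ => hAx i j).const_mul (v i)
      simpa using this
    -- As x(t) lies in the simplex, v·x(t) is at least the smallest coordinate of v.
    · obtain ⟨i₀, -, hi₀⟩ := Finset.exists_min_image Finset.univ v Finset.univ_nonempty
      refine isBoundedUnder_of ⟨(v i₀)⁻¹, fun t => ?_⟩
      rw [Function.comp, Real.norm_of_nonneg (inv_nonneg.2 (hvx t).le)]
      refine inv_anti₀ ((h θ).left_pos i₀) ?_
      calc v i₀ = ∑ j, v i₀ * x t j := by rw [← Finset.mul_sum, (hx t).2, mul_one]
        _ ≤ v ⬝ᵥ x t := Finset.sum_le_sum fun j hj =>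
          mul_le_mul_of_nonneg_right (hi₀ j hj) ((hx t).1 j)
  have hlim : Tendsto (fun t => A θ *ᵥ x t - rho p θ • x t) (𝓝 θ) (𝓝 0) := by
    rw [tendsto_pi_nhds]
    intro i
    have h1 : ∀ t, (A θ *ᵥ x t - rho p θ • x t) i
        = (rho p t - rho p θ) * x t i - ∑ j, (A t i j - A θ i j) * x t j := fun t => by
      have h2 : ∑ j, A t i j * x t j = rho p t * x t i := congrFun (h t).mulVec_eq i
      simp only [sub_mul, Finset.sum_sub_distrib, h2, Pi.sub_apply, Pi.smul_apply, smul_eq_mul,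
        Matrix.mulVec, dotProduct]
      ring
    simp only [h1]
    have h3 := ((tendsto_sub_nhds_zero_iff.2 hrho).zero_mul_isBoundedUnder_le (hbdd i)).sub
      (tendsto_finsetSum Finset.univ fun j _ => hAx i j)
    simpa using h3
  have hxlim : Tendsto x (𝓝 θ) (𝓝 (x θ)) := by
    -- Every cluster point in the compact simplex is an eigenvector of A(θ) for ρ(θ), hence equals
    -- x(θ) by simplicity and normalization.
    refine (isCompact_stdSimplex ℝ (Fin K)).tendsto_nhds_of_unique_mapClusterPt
      (Eventually.of_forall hx) fun y hy hcl => ?_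
    have hG : Continuous fun u : Fin K → ℝ => A θ *ᵥ u - rho p θ • u := by fun_prop
    have hcl' := hcl.continuousAt_comp hG.continuousAt
    have h0 : A θ *ᵥ y - rho p θ • y = 0 := by
      have : ClusterPt (A θ *ᵥ y - rho p θ • y) (𝓝 0) := hcl'.clusterPt.mono hlim
      exact eq_of_nhds_neBot this
    have hy1 := (h θ).eq_smul (powMatrix_isPrimitive hp θ) (sub_eq_zero.1 h0)
    set c := (w θ ⬝ᵥ y) / (w θ ⬝ᵥ x θ)
    have hc : c = 1 := by
      have h2 := hy.2
      rw [hy1] at h2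
      simpa only [Pi.smul_apply, smul_eq_mul, ← Finset.mul_sum, (hx θ).2, mul_one] using h2
    rw [hy1, hc, one_smul]
  refine HasDerivAt.differentiableAt (f' := (∑ i, v i * ∑ j, deriv (fun t => A t i j) θ * x θ j)
    * (v ⬝ᵥ x θ)⁻¹) ?_
  rw [hasDerivAt_iff_tendsto_slope]
  have hslope : slope (rho p) θ = fun t =>
      (∑ i, v i * ∑ j, slope (fun t => A t i j) θ t * x t j) * (v ⬝ᵥ x t)⁻¹ := by
    ext t
    rw [slope_def_field, key, mul_comm, mul_div_assoc, mul_comm, Finset.sum_div]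
    congr 1
    refine Finset.sum_congr rfl fun i _ => ?_
    rw [mul_div_assoc, Finset.sum_div]
    congr 1
    refine Finset.sum_congr rfl fun j _ => ?_
    rw [slope_def_field]
    ring
  rw [hslope]
  have hxl := hxlim.mono_left (nhdsWithin_le_nhds (s := {θ}ᶜ))
  have hxj : ∀ j, Tendsto (fun t => x t j) (𝓝[≠] θ) (𝓝 (x θ j)) := fun j =>
    (tendsto_pi_nhds.1 hxl) j
  refine Tendsto.mul ?_ (Tendsto.inv₀ ?_ (hvx θ).ne')
  · exact tendsto_finsetSum _ fun i _ => (tendsto_finsetSum _ fun j _ =>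
      (hasDerivAt_iff_tendsto_slope.1 (differentiableAt_powMatrix p θ i j).hasDerivAt).mul
        (hxj j)).const_mul _
  · exact tendsto_finsetSum _ fun i _ => (hxj i).const_mul _

theorem powMatrix_one (p : Matrix (Fin K) (Fin K) ℝ) : powMatrix p 1 = p := by
  ext i j
  simp +contextual [powMatrix]

theorem rho_one [Nonempty (Fin K)] (hp : p.IsPrimitive)
    (hstoch : p ∈ Matrix.rowStochastic ℝ (Fin K)) : rho p 1 = 1 := by
  obtain ⟨x, w, -, h⟩ := exists_isPerronTriple_rho hp 1
  refine (Matrix.eigenvalue_eq_of_pos (x := 1) (fun _ => one_pos) h.left_pos ?_ h.vecMul_eq).symm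
  rw [powMatrix_one, Matrix.one_vecMul_of_mem_rowStochastic hstoch, one_smul]

end MarkovBoxes

/-! ### Moments of box sizes, window sums and exponential tilting. -/

namespace MarkovBoxes

/-- The power `s ^ t` with the convention `0 ^ t = 0` for every `t`. -/
noncomputable def zeroPow (t s : ℝ) : ℝ := if s = 0 then 0 else s ^ t

theorem zeroPow_zero (t : ℝ) : zeroPow t 0 = 0 := if_pos rfl

theorem zeroPow_of_pos (t : ℝ) {s : ℝ} (hs : 0 < s) : zeroPow t s = Real.exp (t * Real.log s) := by
  rw [zeroPow, if_neg hs.ne', Real.rpow_def_of_pos hs, mul_comm]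

theorem zeroPow_nonneg (t : ℝ) {s : ℝ} (hs : 0 ≤ s) : 0 ≤ zeroPow t s := by
  rw [zeroPow]
  split_ifs
  exacts [le_rfl, Real.rpow_nonneg hs t]

theorem zeroPow_mul (t : ℝ) {a b : ℝ} (ha : 0 ≤ a) (hb : 0 ≤ b) :
    zeroPow t (a * b) = zeroPow t a * zeroPow t b := by
  rcases ha.eq_or_lt with rfl | ha'
  · simp [zeroPow_zero]
  rcases hb.eq_or_lt with rfl | hb'
  · simp [zeroPow_zero]
  simp [zeroPow, ha'.ne', hb'.ne', Real.mul_rpow ha hb]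

theorem zeroPow_one (s : ℝ) : zeroPow 1 s = s := by
  simp +contextual [zeroPow, eq_comm]

variable {K : ℕ} {p : Matrix (Fin K) (Fin K) ℝ}

theorem boxSize_nonneg (hp : ∀ i j, 0 ≤ p i j) (i₀ : Fin K) :
    ∀ (n : ℕ) (u : Fin n → Fin K), 0 ≤ boxSize p i₀ n u
  | 0, _ => zero_le_one
  | n + 1, u => mul_nonneg (boxSize_nonneg hp i₀ n (Fin.init u)) (hp _ _)

theorem boxSize_snocEquiv (p : Matrix (Fin K) (Fin K) ℝ) (i₀ : Fin K) (n : ℕ) (k : Fin K)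
    (u : Fin n → Fin K) : boxSize p i₀ (n + 1) (Fin.snocEquiv (fun _ => Fin K) (k, u)) =
      boxSize p i₀ n u * p (boxType i₀ n u) k := by
  have h1 : Fin.init (Fin.snocEquiv (fun _ => Fin K) (k, u)) = u :=
    congrArg Prod.snd ((Fin.snocEquiv fun _ => Fin K).symm_apply_apply (k, u))
  have h2 : Fin.snocEquiv (fun _ => Fin K) (k, u) (Fin.last n) = k :=
    congrArg Prod.fst ((Fin.snocEquiv fun _ => Fin K).symm_apply_apply (k, u))
  rw [boxSize, h1, h2]

theorem boxType_snocEquiv (i₀ : Fin K) (n : ℕ) (k : Fin K) (u : Fin n → Fin K) :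
    boxType i₀ (n + 1) (Fin.snocEquiv (fun _ => Fin K) (k, u)) = k :=
  congrArg Prod.fst ((Fin.snocEquiv fun _ => Fin K).symm_apply_apply (k, u))

-- Sizes are multiplicative along words, so summing over the last letter applies A(t) to x once.
open scoped Matrix in
theorem sum_zeroPow_boxSize_mul (hp : ∀ i j, 0 ≤ p i j) (i₀ : Fin K) {t r : ℝ} {x : Fin K → ℝ}
    (h : powMatrix p t *ᵥ x = r • x) (n : ℕ) :
    ∑ u : Fin n → Fin K, zeroPow t (boxSize p i₀ n u) * x (boxType i₀ n u) = r ^ n * x i₀ := by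
  induction n with
  | zero => simp [boxSize, boxType, zeroPow]
  | succ n ih =>
    have hx : ∀ i, ∑ j, zeroPow t (p i j) * x j = r * x i := congrFun h
    rw [← (Fin.snocEquiv fun _ => Fin K).sum_comp, Fintype.sum_prod_type_right]
    simp only [boxSize_snocEquiv, boxType_snocEquiv,
      zeroPow_mul t (boxSize_nonneg hp i₀ n _) (hp _ _), mul_assoc, ← Finset.mul_sum, hx]
    rw [pow_succ', mul_assoc, ← ih, Finset.mul_sum]
    exact Finset.sum_congr rfl fun u _ => by ring

/-- The moments of the box sizes grow like `ρ(t) ^ n`. -/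
theorem exists_bounds_sum_zeroPow [Nonempty (Fin K)] (hp : p.IsPrimitive) (i₀ : Fin K) (t : ℝ) :
    ∃ c > 0, ∃ C > 0, ∀ n : ℕ,
      c * Real.exp (n * Real.log (rho p t)) ≤ ∑ u, zeroPow t (boxSize p i₀ n u) ∧
      ∑ u, zeroPow t (boxSize p i₀ n u) ≤ C * Real.exp (n * Real.log (rho p t)) := by
  obtain ⟨x, w, -, h⟩ := exists_isPerronTriple_rho hp t
  obtain ⟨i₁, -, hi₁⟩ := Finset.exists_min_image Finset.univ x Finset.univ_nonempty
  obtain ⟨i₂, -, hi₂⟩ := Finset.exists_max_image Finset.univ x Finset.univ_nonempty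
  have h0 := h.right_pos i₀
  have h1 := h.right_pos i₁
  have h2 := h.right_pos i₂
  have hz : ∀ (n : ℕ) (u : Fin n → Fin K), 0 ≤ zeroPow t (boxSize p i₀ n u) := fun n u =>
    zeroPow_nonneg t (boxSize_nonneg hp.nonneg i₀ n u)
  refine ⟨x i₀ / x i₂, div_pos h0 h2, x i₀ / x i₁, div_pos h0 h1, fun n => ?_⟩
  rw [Real.exp_nat_mul, Real.exp_log (rho_pos hp t), div_mul_eq_mul_div, div_mul_eq_mul_div,
    div_le_iff₀ h2, le_div_iff₀ h1, mul_comm (x i₀), ← sum_zeroPow_boxSize_mul hp.nonneg i₀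
      h.mulVec_eq n, Finset.sum_mul, Finset.sum_mul]
  exact ⟨Finset.sum_le_sum fun u _ => mul_le_mul_of_nonneg_left (hi₂ _ (Finset.mem_univ _)) (hz n u),
    Finset.sum_le_sum fun u _ => mul_le_mul_of_nonneg_left (hi₁ _ (Finset.mem_univ _)) (hz n u)⟩

open Classical in
/-- The sum of the powers `s ^ τ` of the sizes `s` of the boxes of generation `n` with
`e ^ (n a) < s < e ^ (n b)`. -/
noncomputable def windowSum (p : Matrix (Fin K) (Fin K) ℝ) (i₀ : Fin K) (τ a b : ℝ) (n : ℕ) : ℝ :=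
  ∑ u : Fin n → Fin K, if boxSize p i₀ n u ∈ Set.Ioo (Real.exp (n * a)) (Real.exp (n * b))
    then zeroPow τ (boxSize p i₀ n u) else 0

theorem windowSum_mono (hp : ∀ i j, 0 ≤ p i j) (i₀ : Fin K) (τ : ℝ) {a b a' b' : ℝ} (ha : a' ≤ a)
    (hb : b ≤ b') (n : ℕ) : windowSum p i₀ τ a b n ≤ windowSum p i₀ τ a' b' n := by
  classical
  refine Finset.sum_le_sum fun u _ => ?_
  have hz := zeroPow_nonneg τ (boxSize_nonneg hp i₀ n u)
  split_ifs with h1 h2 h2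
  · exact le_rfl
  · refine absurd ⟨lt_of_le_of_lt ?_ h1.1, lt_of_lt_of_le h1.2 ?_⟩ h2 <;> gcongr
  · exact hz
  · exact le_rfl

theorem windowSum_le (hp : ∀ i j, 0 ≤ p i j) (i₀ : Fin K) (τ a b : ℝ) (n : ℕ) :
    windowSum p i₀ τ a b n ≤ ∑ u, zeroPow τ (boxSize p i₀ n u) := by
  classical
  refine Finset.sum_le_sum fun u _ => ?_
  have hz := zeroPow_nonneg τ (boxSize_nonneg hp i₀ n u)
  split_ifs
  exacts [le_rfl, hz]

/-- Change of the exponent in a window sum. -/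
theorem windowSum_le_mul_exp (i₀ : Fin K) {τ t a b e : ℝ}
    (he : ∀ y ∈ Set.Ioo a b, (τ - t) * y ≤ e) (n : ℕ) :
    windowSum p i₀ τ a b n ≤ windowSum p i₀ t a b n * Real.exp (n * e) := by
  classical
  rw [windowSum, windowSum, Finset.sum_mul]
  refine Finset.sum_le_sum fun u _ => ?_
  split_ifs with h
  · have hs : 0 < boxSize p i₀ n u := (Real.exp_pos _).trans h.1
    rw [zeroPow_of_pos τ hs, zeroPow_of_pos t hs, ← Real.exp_add, Real.exp_le_exp]
    have h1 := (Real.lt_log_iff_exp_lt hs).2 h.1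
    have h2 := (Real.log_lt_iff_lt_exp hs).2 h.2
    set l := Real.log (boxSize p i₀ n u)
    -- For n = 0 the window is the empty interval (1, 1), so dividing by n is legitimate.
    have hn : (0 : ℝ) < n := by
      rcases Nat.eq_zero_or_pos n with rfl | hn
      · simp only [Nat.cast_zero, zero_mul] at h1 h2
        exact absurd (h1.trans h2) (lt_irrefl _)
      · exact_mod_cast hn
    have h3 := he (l / n) ⟨by rwa [lt_div_iff₀ hn, mul_comm], by rwa [div_lt_iff₀ hn, mul_comm]⟩
    have h4 : n * ((τ - t) * (l / n)) = (τ - t) * l := by field_simp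
    have h5 := mul_le_mul_of_nonneg_left h3 hn.le
    rw [h4] at h5
    linarith
  · simp

theorem exists_windowSum_le [Nonempty (Fin K)] (hp : p.IsPrimitive) (i₀ : Fin K) {τ t a b e : ℝ}
    (he : ∀ y ∈ Set.Ioo a b, (τ - t) * y ≤ e) :
    ∃ C > 0, ∀ n : ℕ, windowSum p i₀ τ a b n ≤ C * Real.exp (n * (Real.log (rho p t) + e)) := by
  obtain ⟨_, _, C, hC, h⟩ := exists_bounds_sum_zeroPow hp i₀ t
  refine ⟨C, hC, fun n => (windowSum_le_mul_exp i₀ he n).trans ?_⟩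
  rw [mul_add, Real.exp_add, ← mul_assoc]
  exact mul_le_mul_of_nonneg_right ((windowSum_le hp.nonneg i₀ t a b n).trans (h n).2)
    (Real.exp_pos _).le

/-- Pointwise Markov inequality for both tails: d > 0 serves the large sizes, d < 0 the small ones.
-/
theorem zeroPow_le_tilt {s d y : ℝ} (t : ℝ) (hs : 0 < s) (h : d * y ≤ d * Real.log s) :
    zeroPow t s ≤ zeroPow (t + d) s * Real.exp (-(d * y)) := by
  rw [zeroPow_of_pos _ hs, zeroPow_of_pos _ hs, ← Real.exp_add, Real.exp_le_exp]
  linarith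

theorem eventually_mul_exp_le {C c α β : ℝ} (hc : 0 < c) (h : α < β) :
    ∀ᶠ n : ℕ in atTop, C * Real.exp (n * α) ≤ c * Real.exp (n * β) := by
  have h1 : Tendsto (fun n : ℕ => C * Real.exp (-((β - α) * n))) atTop (𝓝 (C * 0)) :=
    (Real.tendsto_exp_neg_atTop_nhds_zero.comp
      (tendsto_natCast_atTop_atTop.const_mul_atTop (sub_pos.2 h))).const_mul C
  rw [mul_zero] at h1
  filter_upwards [h1.eventually_lt_const hc] with n hn
  calc C * Real.exp (n * α) = C * Real.exp (-((β - α) * n)) * Real.exp (n * β) := by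
        rw [mul_assoc, ← Real.exp_add]; congr 2; ring
    _ ≤ _ := mul_le_mul_of_nonneg_right hn.le (Real.exp_pos _).le

/-- With f = Λ, the left side is the Chernoff exponent of the tail above b, strictly smaller than
that of the full moment. -/
theorem exists_tilt_lt {f : ℝ → ℝ} {t D b : ℝ} (h : HasDerivAt f D t) (hb : D < b) :
    ∃ d > 0, f (t + d) - d * b < f t := by
  have h1 := h.tendsto_slope_zero_right.eventually_lt_const hb
  obtain ⟨d, hd, hd0⟩ := (h1.and self_mem_nhdsWithin).exists
  replace hd0 : 0 < d := hd0
  refine ⟨d, hd0, ?_⟩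
  rw [smul_eq_mul, inv_mul_lt_iff₀ hd0] at hd
  linarith

/-- Boxes whose size has the typical exponent under the tilt `t` carry a positive fraction of the
moment of order `t`. -/
theorem exists_le_windowSum_self [Nonempty (Fin K)] (hp : p.IsPrimitive) (i₀ : Fin K)
    {t a b D : ℝ} (hD : HasDerivAt (fun t => Real.log (rho p t)) D t) (ha : a < D) (hb : D < b) :
    ∃ c > 0, ∀ᶠ n : ℕ in atTop,
      c * Real.exp (n * Real.log (rho p t)) ≤ windowSum p i₀ t a b n := by
  classical
  set Λ := fun t => Real.log (rho p t)
  obtain ⟨d₁, hd₁, h₁⟩ := exists_tilt_lt hD hb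
  obtain ⟨d₂, hd₂, h₂⟩ : ∃ d < 0, Λ (t + d) - d * a < Λ t := by
    have hneg : HasDerivAt (fun s => Λ (-s)) (-D) (-t) := by
      have := HasDerivAt.comp (-t) (h₂ := Λ) (by rwa [neg_neg]) (hasDerivAt_neg (-t))
      simpa [Function.comp_def] using this
    obtain ⟨d, hd, h⟩ := exists_tilt_lt hneg (neg_lt_neg ha)
    refine ⟨-d, by linarith, ?_⟩
    simp only [neg_add, neg_neg] at h
    linarith
  obtain ⟨c, hc, _, _, hlow⟩ := exists_bounds_sum_zeroPow hp i₀ t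
  obtain ⟨_, _, C₁, hC₁, hup₁⟩ := exists_bounds_sum_zeroPow hp i₀ (t + d₁)
  obtain ⟨_, _, C₂, hC₂, hup₂⟩ := exists_bounds_sum_zeroPow hp i₀ (t + d₂)
  refine ⟨c / 2, by positivity, ?_⟩
  -- Each tail eventually takes at most c/4 of the lower bound c for the full moment, leaving c/2
  -- for the window.
  filter_upwards [eventually_mul_exp_le (C := C₁) (c := c / 4) (by positivity) h₁,
    eventually_mul_exp_le (C := C₂) (c := c / 4) (by positivity) h₂] with n hn₁ hn₂
  have hpt : ∀ u : Fin n → Fin K, zeroPow t (boxSize p i₀ n u) ≤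
      (if boxSize p i₀ n u ∈ Set.Ioo (Real.exp (n * a)) (Real.exp (n * b))
        then zeroPow t (boxSize p i₀ n u) else 0)
      + zeroPow (t + d₁) (boxSize p i₀ n u) * Real.exp (-(d₁ * (n * b)))
      + zeroPow (t + d₂) (boxSize p i₀ n u) * Real.exp (-(d₂ * (n * a))) := by
    intro u
    have hs := boxSize_nonneg hp.nonneg i₀ n u
    set s := boxSize p i₀ n u
    have hp₁ := mul_nonneg (zeroPow_nonneg (t + d₁) hs) (Real.exp_pos (-(d₁ * (n * b)))).le
    have hp₂ := mul_nonneg (zeroPow_nonneg (t + d₂) hs) (Real.exp_pos (-(d₂ * (n * a)))).le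
    split_ifs with h
    · linarith
    rcases hs.eq_or_lt with h0 | h0
    · rw [← h0]; simp [zeroPow_zero]
    rcases le_or_gt s (Real.exp (n * a)) with hsa | hsa
    · have := zeroPow_le_tilt t h0 (mul_le_mul_of_nonpos_left
        ((Real.log_le_iff_le_exp h0).2 hsa) hd₂.le)
      linarith
    · have hsb : Real.exp (n * b) ≤ s := not_lt.1 fun h' => h ⟨hsa, h'⟩
      have := zeroPow_le_tilt t h0 (mul_le_mul_of_nonneg_left
        ((Real.le_log_iff_exp_le h0).2 hsb) hd₁.le)
      linarith
  have hsum := Finset.sum_le_sum fun u (_ : u ∈ Finset.univ) => hpt u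
  simp only [Finset.sum_add_distrib, ← Finset.sum_mul] at hsum
  have hexp : ∀ {C S q d y : ℝ}, S ≤ C * Real.exp (n * q) →
      S * Real.exp (-(d * (n * y))) ≤ C * Real.exp (n * (q - d * y)) := fun {C S q d y} h => by
    have h1 : Real.exp (n * (q - d * y)) = Real.exp (n * q) * Real.exp (-(d * (n * y))) := by
      rw [← Real.exp_add]; congr 1; ring
    rw [h1, ← mul_assoc C]
    exact mul_le_mul_of_nonneg_right h (Real.exp_pos _).le
  have e₁ := hexp (d := d₁) (y := b) (hup₁ n).2
  have e₂ := hexp (d := d₂) (y := a) (hup₂ n).2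
  have e₀ := (hlow n).1
  change _ ≤ windowSum p i₀ t a b n + _ + _ at hsum
  simp only [Λ] at hn₁ hn₂
  linarith

/-- The lower bound: tilting by `t` makes the exponent `Λ'(t)` typical. -/
theorem exists_le_windowSum [Nonempty (Fin K)] (hp : p.IsPrimitive) (i₀ : Fin K)
    {τ t a b D α : ℝ} (hD : HasDerivAt (fun t => Real.log (rho p t)) D t) (hab : D ∈ Set.Ioo a b)
    (hα : α < Real.log (rho p t) + (τ - t) * D) :
    ∃ c > 0, ∀ᶠ n : ℕ in atTop, c * Real.exp (n * α) ≤ windowSum p i₀ τ a b n := by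
  have hcont : Tendsto (fun y => (τ - t) * y) (𝓝 D) (𝓝 ((τ - t) * D)) :=
    (continuous_const.mul continuous_id).tendsto D
  -- Shrink the window around D until (τ - t) y stays above α - Λ(t); it still carries the tilted
  -- mass, and passing from t to τ costs no more than the slack in α.
  have hev := (hcont.eventually_const_lt (sub_lt_iff_lt_add'.2 hα)).and (Ioo_mem_nhds hab.1 hab.2)
  obtain ⟨a', b', hD', hsub⟩ := mem_nhds_iff_exists_Ioo_subset.1 hev
  obtain ⟨c, hc, h⟩ := exists_le_windowSum_self hp i₀ hD hD'.1 hD'.2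
  have hlt : a' < b' := hD'.1.trans hD'.2
  have haa : Set.Ioo a' b' ⊆ Set.Ioo a b := fun y hy => (hsub hy).2
  obtain ⟨ha', hb'⟩ := (Set.Ioo_subset_Ioo_iff hlt).1 haa
  refine ⟨c, hc, h.mono fun n hn => ?_⟩
  have h1 := windowSum_le_mul_exp (p := p) i₀ (τ := t) (t := τ) (a := a') (b := b')
    (e := Real.log (rho p t) - α) (fun y hy => by
      have : α - Real.log (rho p t) < (τ - t) * y := (hsub hy).1
      linarith) n
  have h2 := (hn.trans h1).trans (mul_le_mul_of_nonneg_right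
    (windowSum_mono hp.nonneg i₀ τ ha' hb' n) (Real.exp_pos _).le)
  refine le_of_mul_le_mul_right ?_ (Real.exp_pos (n * (Real.log (rho p t) - α)))
  rw [mul_assoc, ← Real.exp_add]
  convert h2 using 3
  ring

end MarkovBoxes

/-! ### Growth rates of window sums and the Legendre transform. -/

namespace MarkovBoxes

theorem le_of_eventually_exp_le {W : ℕ → ℝ} {c C α β : ℝ} (hc : 0 < c)
    (hlow : ∀ᶠ n : ℕ in atTop, c * Real.exp (n * α) ≤ W n)
    (hup : ∀ n : ℕ, W n ≤ C * Real.exp (n * β)) : α ≤ β := by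
  by_contra! hlt
  obtain ⟨n, h1, h2⟩ := (hlow.and
    (eventually_mul_exp_le (C := C) (c := c / 2) (by positivity) hlt)).exists
  have h3 : 0 < c * Real.exp (n * α) := by positivity
  linarith [hup n]

/-- A sequence squeezed between exponentials has an exponential growth rate. -/
theorem tendsto_log_div_of_exp_bounds {W : ℕ → ℝ} {L : ℝ}
    (hlow : ∀ α < L, ∃ c > 0, ∀ᶠ n : ℕ in atTop, c * Real.exp (n * α) ≤ W n)
    (hup : ∃ C > 0, ∀ n : ℕ, W n ≤ C * Real.exp (n * L)) :
    (∀ᶠ n : ℕ in atTop, 0 < W n) ∧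
      Tendsto (fun n : ℕ => 1 / (n : ℝ) * Real.log (W n)) atTop (𝓝 L) := by
  have hlog : ∀ {c : ℝ} (_ : 0 < c) (β : ℝ) (n : ℕ),
      Real.log (c * Real.exp (n * β)) = Real.log c + n * β := fun hc β n => by
    rw [Real.log_mul hc.ne' (Real.exp_pos _).ne', Real.log_exp]
  have hlim : ∀ c β : ℝ,
      Tendsto (fun n : ℕ => 1 / (n : ℝ) * (Real.log c + n * β)) atTop (𝓝 β) := by
    intro c β
    have h1 : Tendsto (fun n : ℕ => Real.log c / (n : ℝ) + β) atTop (𝓝 (0 + β)) :=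
      (tendsto_const_div_atTop_nhds_zero_nat _).add_const β
    rw [zero_add] at h1
    refine h1.congr' ?_
    filter_upwards [eventually_gt_atTop 0] with n hn
    have : (n : ℝ) ≠ 0 := by exact_mod_cast hn.ne'
    field_simp
  have hpos : ∀ᶠ n : ℕ in atTop, 0 < W n := by
    obtain ⟨c, hc, h⟩ := hlow (L - 1) (by linarith)
    exact h.mono fun n hn => lt_of_lt_of_le (by positivity) hn
  refine ⟨hpos, tendsto_order.2 ⟨fun a ha => ?_, fun b hb => ?_⟩⟩
  · obtain ⟨α, haα, hαL⟩ := exists_between ha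
    obtain ⟨c, hc, h⟩ := hlow α hαL
    filter_upwards [h, (hlim c α).eventually_const_lt haα] with n hn hn'
    refine hn'.trans_le (mul_le_mul_of_nonneg_left ?_ (by positivity))
    rw [← hlog hc]
    exact Real.log_le_log (by positivity) hn
  · obtain ⟨C, hC, h⟩ := hup
    filter_upwards [hpos, (hlim C L).eventually_lt_const hb] with n hn hn'
    refine lt_of_le_of_lt (mul_le_mul_of_nonneg_left ?_ (by positivity)) hn'
    rw [← hlog hC]
    exact Real.log_le_log hn (h n)

/-- The optimisation problem of Cramér's theorem on an interval: for a differentiable function lying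
above its tangents, the value of the Legendre transform at the point of the interval which is the
closest to `f' τ` is approached at derivatives inside the interval. -/
theorem exists_legendre_value {f f' : ℝ → ℝ} (hf : ∀ t, HasDerivAt f (f' t) t)
    (htan : ∀ s t, f t + (s - t) * f' t ≤ f s) {θ a b : ℝ} (hθ : f' θ ∈ Set.Ioo a b) (τ : ℝ) :
    ∃ L t, (∀ y ∈ Set.Ioo a b, (τ - t) * y ≤ L - f t) ∧
      ∀ α < L, ∃ s, f' s ∈ Set.Ioo a b ∧ α < f s + (τ - s) * f' s := by
  have hmono : Monotone f' := by
    intro s t hst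
    rcases hst.eq_or_lt with rfl | hst
    · exact le_rfl
    have h1 := htan s t
    have h2 := htan t s
    have h3 : 0 ≤ (t - s) * (f' t - f' s) := by linarith
    have := nonneg_of_mul_nonneg_right h3 (sub_pos.2 hst)
    linarith
  have hw : ∀ {s : Set ℝ}, ∀ x ∈ s, HasDerivWithinAt f (f' x) s x := fun x _ =>
    (hf x).hasDerivWithinAt
  -- If f' τ lies in the window, t = τ is optimal. Otherwise t is chosen with f' t equal to the
  -- nearer endpoint, by Darboux's theorem, so no continuity of f' is needed.
  rcases le_or_gt b (f' τ) with hb | hb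
  · have hθτ : θ < τ := lt_of_not_ge fun h => (hθ.2.trans_le hb).not_ge (hmono h)
    obtain ⟨t, ht, rfl⟩ := exists_hasDerivWithinAt_eq_of_ge_of_le hθτ.le hw hθ.2.le hb
    refine ⟨f t + (τ - t) * f' t, t, fun y hy => ?_, fun α hα => ?_⟩
    · linarith [mul_le_mul_of_nonneg_left hy.2.le (sub_nonneg.2 ht.2)]
    have hc := eventually_mul_lt_of_pos (τ - θ) (sub_pos.2 hα)
    obtain ⟨d, ⟨hd, hd'⟩, hd0⟩ := ((hc.and (nhdsWithin_le_nhds (eventually_lt_nhds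
      (sub_pos.2 hθ.2)))).and self_mem_nhdsWithin).exists
    replace hd0 : 0 < d := hd0
    -- The endpoint is not in the open window, so the derivative is lowered by d; the tangent
    -- inequality shows that this costs at most d (τ - θ).
    obtain ⟨s, hs, hsd⟩ := exists_hasDerivWithinAt_eq_of_ge_of_le ht.1 hw
      (m := f' t - d) (by linarith) (by linarith)
    refine ⟨s, ⟨?_, ?_⟩, ?_⟩
    · linarith [hθ.1]
    · linarith
    · have h1 := htan s t
      have h2 : d * (τ - s) ≤ d * (τ - θ) := mul_le_mul_of_nonneg_left (by linarith [hs.1]) hd0.le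
      rw [hsd]
      linarith
  rcases le_or_gt (f' τ) a with ha | ha
  · have hθτ : τ < θ := lt_of_not_ge fun h => (ha.trans_lt hθ.1).not_ge (hmono h)
    obtain ⟨t, ht, rfl⟩ := exists_hasDerivWithinAt_eq_of_ge_of_le hθτ.le hw ha hθ.1.le
    refine ⟨f t + (τ - t) * f' t, t, fun y hy => ?_, fun α hα => ?_⟩
    · linarith [mul_le_mul_of_nonpos_left hy.1.le (sub_nonpos.2 ht.1)]
    have hc := eventually_mul_lt_of_pos (θ - τ) (sub_pos.2 hα)
    obtain ⟨d, ⟨hd, hd'⟩, hd0⟩ := ((hc.and (nhdsWithin_le_nhds (eventually_lt_nhds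
      (sub_pos.2 hθ.1)))).and self_mem_nhdsWithin).exists
    replace hd0 : 0 < d := hd0
    obtain ⟨s, hs, hsd⟩ := exists_hasDerivWithinAt_eq_of_ge_of_le ht.2 hw
      (m := f' t + d) (by linarith) (by linarith)
    refine ⟨s, ⟨?_, ?_⟩, ?_⟩
    · linarith
    · linarith [hθ.2]
    · have h1 := htan s t
      have h2 : d * (s - τ) ≤ d * (θ - τ) := mul_le_mul_of_nonneg_left (by linarith [hs.2]) hd0.le
      rw [hsd]
      linarith
  · exact ⟨f τ, τ, fun y _ => by simp, fun α hα => ⟨τ, ⟨ha, hb⟩, by simpa using hα⟩⟩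

variable {K : ℕ} {p : Matrix (Fin K) (Fin K) ℝ}

theorem hasDerivAt_log_rho [Nonempty (Fin K)] (hp : p.IsPrimitive) (t : ℝ) :
    HasDerivAt (fun t => Real.log (rho p t)) (deriv (rho p) t / rho p t) t :=
  (differentiableAt_rho hp t).hasDerivAt.log (rho_pos hp t).ne'

/-- The function `ln ρ` lies above its tangents. -/
theorem log_rho_tangent_le [Nonempty (Fin K)] (hp : p.IsPrimitive) (s t : ℝ) :
    Real.log (rho p t) + (s - t) * (deriv (rho p) t / rho p t) ≤ Real.log (rho p s) := by
  obtain ⟨i₀⟩ := ‹Nonempty (Fin K)›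
  set D := deriv (rho p) t / rho p t
  refine le_of_forall_lt fun α hα => ?_
  obtain ⟨β, hαβ, hβ⟩ := exists_between hα
  -- Boxes typical for the tilt t contribute to the moment of order s at rates arbitrarily close to
  -- the tangent value, while the full moment grows only like ρ(s)^n.
  obtain ⟨c, hc, hlow⟩ := exists_le_windowSum hp i₀ (a := D - 1) (b := D + 1)
    (hasDerivAt_log_rho hp t) ⟨by linarith, by linarith⟩ hβ
  obtain ⟨C, -, hup⟩ := exists_windowSum_le hp i₀ (τ := s) (t := s) (a := D - 1) (b := D + 1)
    (e := 0) (fun y _ => by simp)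
  have := le_of_eventually_exp_le hc hlow hup
  linarith

/-- Exponential growth rate of the window sums around the exponent `(ln ρ)'(θ)`. -/
theorem hasExpRate_windowSum [Nonempty (Fin K)] (hp : p.IsPrimitive) (i₀ : Fin K) (τ θ : ℝ) :
    HasExpRate (fun ε => windowSum p i₀ τ (deriv (rho p) θ / rho p θ - ε)
        (deriv (rho p) θ / rho p θ + ε))
      (Real.log (rho p θ) - (θ - τ) * (deriv (rho p) θ / rho p θ)) := by
  set D := deriv (rho p) θ / rho p θ
  have hex : ∀ ε > 0, ∃ L t, (∀ y ∈ Set.Ioo (D - ε) (D + ε), (τ - t) * y ≤ L - Real.log (rho p t)) ∧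
      ∀ α < L, ∃ s, deriv (rho p) s / rho p s ∈ Set.Ioo (D - ε) (D + ε) ∧
        α < Real.log (rho p s) + (τ - s) * (deriv (rho p) s / rho p s) := fun ε hε =>
    exists_legendre_value (hasDerivAt_log_rho hp) (log_rho_tangent_le hp) (θ := θ)
      ⟨by linarith, by linarith⟩ τ
  have hbounds : ∀ ε > 0, ∃ L : ℝ,
      (∀ α < L, ∃ c > 0, ∀ᶠ n : ℕ in atTop,
        c * Real.exp (n * α) ≤ windowSum p i₀ τ (D - ε) (D + ε) n) ∧
      ∃ C > 0, ∀ n : ℕ, windowSum p i₀ τ (D - ε) (D + ε) n ≤ C * Real.exp (n * L) := by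
    intro ε hε
    obtain ⟨L, t, hup, hlow⟩ := hex ε hε
    refine ⟨L, fun α hα => ?_, ?_⟩
    · obtain ⟨s, hs, hαs⟩ := hlow α hα
      exact exists_le_windowSum hp i₀ (hasDerivAt_log_rho hp s) hs hαs
    · simpa using exists_windowSum_le hp i₀ hup
  choose! g hlow hup using hbounds
  -- The inner limit g ε need not be computed: the tilt t = θ bounds it on both sides, with error at
  -- most |τ - θ| ε.
  have hg₁ : ∀ ε > 0, Real.log (rho p θ) - (θ - τ) * D ≤ g ε := by
    intro ε hε
    refine le_of_forall_lt fun α hα => ?_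
    obtain ⟨β, hαβ, hβ⟩ := exists_between hα
    obtain ⟨c, hc, h⟩ := exists_le_windowSum hp i₀ (τ := τ) (a := D - ε) (b := D + ε) (α := β)
      (hasDerivAt_log_rho hp θ) ⟨by linarith, by linarith⟩ (by linarith)
    obtain ⟨C, -, h'⟩ := hup ε hε
    exact hαβ.trans_le (le_of_eventually_exp_le hc h h')
  have hg₂ : ∀ ε > 0, g ε ≤ Real.log (rho p θ) - (θ - τ) * D + |τ - θ| * ε := by
    intro ε hε
    refine le_of_forall_lt fun α hα => ?_
    obtain ⟨β, hαβ, hβ⟩ := exists_between hα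
    obtain ⟨c, hc, h⟩ := hlow ε hε β hβ
    obtain ⟨C, -, h'⟩ := exists_windowSum_le hp i₀ (τ := τ) (t := θ) (a := D - ε) (b := D + ε)
      (e := (τ - θ) * D + |τ - θ| * ε) (fun y hy => by
        have h1 : |y - D| ≤ ε := abs_le.2 ⟨by linarith [hy.1], by linarith [hy.2]⟩
        have h2 : (τ - θ) * (y - D) ≤ |τ - θ| * ε :=
          (le_abs_self _).trans ((abs_mul _ _).trans_le
            (mul_le_mul_of_nonneg_left h1 (abs_nonneg _)))
        linarith)
    have := le_of_eventually_exp_le hc h h'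
    linarith
  refine ⟨g, fun ε hε => tendsto_log_div_of_exp_bounds (hlow ε hε) (hup ε hε), ?_⟩
  have hlim : Tendsto (fun ε : ℝ => Real.log (rho p θ) - (θ - τ) * D + |τ - θ| * ε) (𝓝[>] 0)
      (𝓝 (Real.log (rho p θ) - (θ - τ) * D)) := by
    have h : Tendsto (fun ε : ℝ => Real.log (rho p θ) - (θ - τ) * D + |τ - θ| * ε) (𝓝 0)
        (𝓝 (Real.log (rho p θ) - (θ - τ) * D + |τ - θ| * 0)) :=
      (continuous_const.add (continuous_const.mul continuous_id)).tendsto 0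
    rw [mul_zero, add_zero] at h
    exact h.mono_left nhdsWithin_le_nhds
  exact tendsto_of_tendsto_of_tendsto_of_le_of_le' tendsto_const_nhds hlim
    (eventually_mem_nhdsWithin.mono fun ε hε => hg₁ ε hε)
    (eventually_mem_nhdsWithin.mono fun ε hε => hg₂ ε hε)

/-! ### Probability and count as window sums, and the main theorem. -/

theorem sizeWindow_eq (p : Matrix (Fin K) (Fin K) ℝ) (θ ε : ℝ) (n : ℕ) :
    sizeWindow p θ ε n = Set.Ioo (Real.exp (n * (deriv (rho p) θ / rho p θ - ε)))
      (Real.exp (n * (deriv (rho p) θ / rho p θ + ε))) := by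
  rw [sizeWindow, ← Real.exp_add, ← Real.exp_add, mul_sub, mul_add, sub_eq_add_neg]

theorem sizeBiasedPick_apply (p : Matrix (Fin K) (Fin K) ℝ) (i₀ : Fin K) (n : ℕ)
    (S : Set (Fin n → Fin K)) [DecidablePred (· ∈ S)] :
    sizeBiasedPick p i₀ n S = ∑ u, if u ∈ S then ENNReal.ofReal (boxSize p i₀ n u) else 0 := by
  rw [sizeBiasedPick, Measure.finsetSum_apply]
  refine Finset.sum_congr rfl fun u _ => ?_
  rw [Measure.smul_apply, Measure.dirac_apply, smul_eq_mul, Set.indicator_apply]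
  split_ifs <;> simp

theorem windowProb_eq (hp : ∀ i j, 0 ≤ p i j) (i₀ : Fin K) (θ ε : ℝ) (n : ℕ) :
    windowProb p i₀ θ ε n = windowSum p i₀ 1 (deriv (rho p) θ / rho p θ - ε)
      (deriv (rho p) θ / rho p θ + ε) n := by
  classical
  rw [windowProb, Measure.real, sizeBiasedPick_apply, ENNReal.toReal_sum, windowSum]
  · refine Finset.sum_congr rfl fun u _ => ?_
    simp only [sizeWindow_eq, Set.mem_ofPred_eq, zeroPow_one]
    split_ifs
    · exact ENNReal.toReal_ofReal (boxSize_nonneg hp i₀ n u)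
    · rfl
  · intro u _
    split_ifs <;> simp

/-- Sizes in the window are positive, so their zeroth power is 1 and the convention for size 0 plays
no role. -/
theorem windowCount_eq (p : Matrix (Fin K) (Fin K) ℝ) (i₀ : Fin K) (θ ε : ℝ) (n : ℕ) :
    (windowCount p i₀ θ ε n : ℝ) = windowSum p i₀ 0 (deriv (rho p) θ / rho p θ - ε)
      (deriv (rho p) θ / rho p θ + ε) n := by
  classical
  rw [windowCount, Set.ncard_eq_toFinset_card', Finset.card_eq_sum_ones, Set.toFinset_ofPred,
    Finset.sum_filter, windowSum, Nat.cast_sum]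
  refine Finset.sum_congr rfl fun u _ => ?_
  rw [sizeWindow_eq]
  split_ifs with h
  · rw [zeroPow_of_pos 0 ((Real.exp_pos _).trans h.1), zero_mul, Real.exp_zero, Nat.cast_one]
  · exact Nat.cast_zero

theorem isProbabilityMeasure_sizeBiasedPick (hstoch : p ∈ Matrix.rowStochastic ℝ (Fin K))
    (i₀ : Fin K) (n : ℕ) : IsProbabilityMeasure (sizeBiasedPick p i₀ n) := by
  classical
  have hnn : ∀ i j, 0 ≤ p i j := fun i j => Matrix.nonneg_of_mem_rowStochastic hstoch
  have h := sum_zeroPow_boxSize_mul hnn i₀ (t := 1) (r := 1) (x := 1)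
    (by rw [powMatrix_one, Matrix.one_vecMul_of_mem_rowStochastic hstoch, one_smul]) n
  simp only [zeroPow_one, Pi.one_apply, mul_one, one_pow] at h
  refine ⟨?_⟩
  rw [sizeBiasedPick_apply]
  simp only [Set.mem_univ, if_true]
  rw [← ENNReal.ofReal_sum_of_nonneg fun u _ => boxSize_nonneg hnn i₀ n u, h, ENNReal.ofReal_one]

end MarkovBoxes

theorem mainTheorem7 {K : ℕ} (p : Matrix (Fin K) (Fin K) ℝ)
    (hstoch : p ∈ Matrix.rowStochastic ℝ (Fin K))
    (hirr : p.IsIrreducible) (haper : MarkovBoxes.IsAperiodic p)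
    (i₀ : Fin K) (θ : ℝ) :
    (MarkovBoxes.IsMaxModulusEigenvalue (MarkovBoxes.powMatrix p θ) (MarkovBoxes.rho p θ) ∧
      0 < MarkovBoxes.rho p θ ∧ DifferentiableAt ℝ (MarkovBoxes.rho p) θ) ∧
    (∀ n : ℕ, IsProbabilityMeasure (MarkovBoxes.sizeBiasedPick p i₀ n)) ∧
    MarkovBoxes.phi p θ ≤ 0 ∧
    MarkovBoxes.HasExpRate (MarkovBoxes.windowProb p i₀ θ) (MarkovBoxes.phi p θ) ∧
    MarkovBoxes.HasExpRate (fun ε n => (MarkovBoxes.windowCount p i₀ θ ε n : ℝ))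
      (MarkovBoxes.psi p θ) := by
  have : Nonempty (Fin K) := ⟨i₀⟩
  have hp : p.IsPrimitive := hirr.isPrimitive haper
  refine ⟨⟨MarkovBoxes.isMaxModulusEigenvalue_rho hp θ, MarkovBoxes.rho_pos hp θ,
    MarkovBoxes.differentiableAt_rho hp θ⟩,
    MarkovBoxes.isProbabilityMeasure_sizeBiasedPick hstoch i₀, ?_, ?_, ?_⟩
  -- φ(θ) is the value at 1 of the tangent to ln ρ at θ, and ln ρ(1) = 0.
  · have h := MarkovBoxes.log_rho_tangent_le hp 1 θ
    rw [MarkovBoxes.rho_one hp hstoch, Real.log_one] at h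
    rw [MarkovBoxes.phi]
    linarith
  · rw [funext fun ε => funext (MarkovBoxes.windowProb_eq hp.nonneg i₀ θ ε)]
    exact MarkovBoxes.hasExpRate_windowSum hp i₀ 1 θ
  · simp only [MarkovBoxes.windowCount_eq]
    rw [MarkovBoxes.psi]
    simpa only [sub_zero] using MarkovBoxes.hasExpRate_windowSum hp i₀ 0 θ
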